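/- Let $\mathcal B\subset\mathbb R^n$ (behavior profiles of $n$ agents) and $\mathcal H\subset\mathbb R^d$ (signals) be finite sets, and let $\Theta$ be a bounded set of parameters $\omega=(\omega_1,\dots,\omega_n)$, $\omega_i\in\mathbb R^{n+d+1}$. For $\omega\in\Theta$ let $M^\omega_h(b,\cdot)$ be the truncated Gaussian transition probability on $\mathcal B$, $$M^\omega_h(b,b')=\frac{\exp\big(-\sum_{i=1}^n(b'_i-\langle\omega_i,(b,h,1)\rangle)^2\big)}{\sum_{c\in\mathcal B}\exp\big(-\sum_{i=1}^n(c_i-\langle\omega_i,(b,h,1)\rangle)^2\big)},\qquad b,b'\in\mathcal B,\ h\in\mathcal H,$$ and put $\|M-M'\|_\infty=\max_{h,b}\sum_{b'}|M_h(b,b')-M'_h(b,b')|$ (which is at least the largest entrywise difference). There is a constant $C_1>0$, depending only on $\mathcal B,\mathcal H,\Theta$, such that the following holds. Let the true model be $M^*=M^{\omega^*}$ with $\omega^*\in\Theta$, let the mechanism $a_0$ be fixed, and let the users $u_1,u_2,\dots$ be i.i.d., each independent of everything before its arrival. Let the signal at time $t$ be $h_t=\mathrm{sig}(a_0,b_t,u_t)$,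 and let the behaviors satisfy $P(b_{t+1}=b'\mid b_1,\dots,b_t,u_1,\dots,u_t)=M^*_{h_t}(b_t,b')$ for all $b'\in\mathcal B$, with an arbitrary law of $b_1$. Assume that for some integer $N_0\ge1$ all entries of the $N_0$-step transition probability matrix of the Markov chain $(b_{t+1},b_t,h_t)$ on $\mathcal B\times\mathcal B\times\mathcal H$ are positive, and let $\delta_0>0$ be the smallest of them. Then for every $\varepsilon>0$, every integer $T_1>2C_1N_0/(|\mathcal B|^2|\mathcal H|\delta_0\varepsilon)$ and every maximum likelihood estimate $\hat\omega$, that is, every maximizer over $\Theta$ of $\prod_{t=1}^{T_1}M^\omega_{h_t}(b_t,b_{t+1})$, the learned model $\hat M_{T_1}=M^{\hat\omega}$ satisfies $$P\big(\|\hat M_{T_1}-M^*\|_\infty\ge\varepsilon\big)\le 2\exp\Big(-\frac{(T_1\varepsilon|\mathcal B|^2|\mathcal H|\delta_0-2C_1N_0)^2}{2T_1N_0^2C_1^2}\Big).$$ For fixed $\varepsilon$ the right-hand side decays exponentially in $T_1$: it is $O(e^{-cT_1})$ as $T_1\to\infty$, with $c=\dfrac{(\varepsilon|\mathcal B|^2|\mathcal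 H|\delta_0)^2}{2N_0^2C_1^2}>0$. -/

import Mathlib

open MeasureTheory ProbabilityTheory Filter Asymptotics

noncomputable section

/-- The feature vector `(b, h, 1)` built from a behavior profile `b` of `n` agents and a
signal `h` with `d` real coordinates. -/
def feature {n d : ℕ} (b : Fin n → ℝ) (h : Fin d → ℝ) : Fin n ⊕ Fin d ⊕ Unit → ℝ :=
  Sum.elim b (Sum.elim h (fun _ => 1))

/-- Parameters of the behavior model: one weight vector `ω i` for every agent `i`. -/
abbrev Param (n d : ℕ) : Type := Fin n → (Fin n ⊕ Fin d ⊕ Unit) → ℝ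

/-- The Gaussian weight `exp (-∑ᵢ (b'ᵢ - ⟨ωᵢ, (b, h, 1)⟩)²)`; for one agent this is
`exp (-(b' - ⟨ω, (b, h, 1)⟩)²)`. -/
def gaussWeight {n d : ℕ} (ω : Param n d) (h : Fin d → ℝ) (b b' : Fin n → ℝ) : ℝ :=
  Real.exp (-∑ i, (b' i - ω i ⬝ᵥ feature b h) ^ 2)

/-- The truncated Gaussian behavior model on the finite behavior space `B`:
`gaussModel ω h b b'` is the probability `M_h(b, b')` that the next behavior is `b'`, given the
current behavior `b` and the signal `h`; it is proportional to the Gaussian weight. -/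
def gaussModel {n d : ℕ} {B : Finset (Fin n → ℝ)} {H : Finset (Fin d → ℝ)} (ω : Param n d)
    (h : H) (b b' : B) : ℝ :=
  gaussWeight ω h.1 b.1 b'.1 / ∑ c : B, gaussWeight ω h.1 b.1 c.1

/-- The infinity distance of two behavior models: the largest, over all signals `h`, of the
matrix infinity norm (maximal absolute row sum) of `M_h - M'_h`. -/
def modelDist {B H : Type*} [Fintype B] (M M' : H → B → B → ℝ) : ℝ :=
  ⨆ p : H × B, ∑ b' : B, |M p.1 p.2 b' - M' p.1 p.2 b'|

/-- The information available at time `t`: the behaviors and the users up to and including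
time `t`. -/
abbrev history {S B U : Type*} [MeasurableSpace B] [MeasurableSpace U]
    (b : ℕ → S → B) (u : ℕ → S → U) (t : ℕ) : MeasurableSpace S :=
  ⨆ i ∈ Set.Iic t, (MeasurableSpace.comap (b i) inferInstance ⊔
    MeasurableSpace.comap (u i) inferInstance)

/-- The information available just before the user of time `t` arrives: the behaviors up to and
including time `t` and the users before time `t`. -/
abbrev preUserHistory {S B U : Type*} [MeasurableSpace B] [MeasurableSpace U]
    (b : ℕ → S → B) (u : ℕ → S → U) (t : ℕ) : MeasurableSpace S :=
  (⨆ i ∈ Set.Iic t, MeasurableSpace.comap (b i) inferInstance) ⊔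
    ⨆ i ∈ Set.Iio t, MeasurableSpace.comap (u i) inferInstance

/-- The process of behaviors `b t` and users `u t` under a fixed mechanism, whose signal at time
`t` is `sig (b t) (u t)`: every user has law `ν` and is independent of everything that happened
before its arrival (so the users are i.i.d.), and given the past the next behavior `b (t + 1)` has
the law `M_h(b t, ·)`, where `h` is the signal at time `t`. The law of `b 0` is arbitrary. -/
structure IsBehaviorProcess {S B H U : Type*} [MeasurableSpace S] [MeasurableSpace B]
    [MeasurableSpace U] (M : H → B → B → ℝ) (sig : B → U → H) (ν : Measure U) (μ : Measure S)
    (b : ℕ → S → B) (u : ℕ → S → U) : Prop where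
  measurable_behavior : ∀ t, Measurable (b t)
  measurable_user : ∀ t, Measurable (u t)
  law_user : ∀ t, μ.map (u t) = ν
  indep_user : ∀ t, Indep (MeasurableSpace.comap (u t) inferInstance) (preUserHistory b u t) μ
  markov : ∀ t (c : B), μ[(b (t + 1) ⁻¹' {c}).indicator (fun _ => (1 : ℝ)) | history b u t]
    =ᵐ[μ] fun s => M (sig (b t s) (u t s)) (b t s) c

/-- The transition matrix of the Markov chain of triples `(b (t + 1), b t, h t)`: from the state
`(c', c, g)` the chain moves to `(b', b, h)` with `b = c'`, with `h` distributed as the signal of a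
random user at behavior `b`, and with `b'` distributed according to `M_h(b, ·)`. -/
def tripleTransition {B H U : Type*} [DecidableEq B] [MeasurableSpace U]
    (M : H → B → B → ℝ) (sig : B → U → H) (ν : Measure U) : Matrix (B × B × H) (B × B × H) ℝ :=
  fun z z' => if z'.2.1 = z.1 then
    ν.real {v | sig z'.2.1 v = z'.2.2} * M z'.2.2 z'.2.1 z'.1 else 0

/-- `ω` is a maximum likelihood estimate in the parameter set `Θ`, given `T` observed transitions
`b t → b (t + 1)` under the signals `h t`, `t < T`. -/
def IsMaxLikelihood {n d : ℕ} {B : Finset (Fin n → ℝ)} {H : Finset (Fin d → ℝ)}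
    (Θ : Set (Param n d)) (T : ℕ) (b : ℕ → B) (h : ℕ → H) (ω : Param n d) : Prop :=
  ω ∈ Θ ∧ IsMaxOn (fun w => ∏ t ∈ Finset.range T, gaussModel w (h t) (b t) (b (t + 1))) Θ ω

end

/-!
The behaviors, together with the signals, form a finite Markov chain of triples
`z t = (b (t + 1), b t, h t)`, and the log-likelihood of a model is linear in the numbers of visits
of this chain to the triples. The proof bounds the deviation of finitely many such counts, uniformly
in the parameter, so that no covering of `Θ` is needed.

*Deterministic part* (`visits_mul_modelDist_sq_le`). The total score of a triple `x = (b', b, h)` is the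
number of visits to `x` minus `M*_h(b, b')` times the number of visits to `(b, h)`. The
log-likelihood ratio of the maximum likelihood estimate and the true model is nonnegative. It equals
a linear combination of the scores, with coefficients at most `D / p` in absolute value, where `D` is
the distance of the two models and `p` a lower bound for the transition probabilities over `Θ`, minus
the sum of the relative entropies of the rows weighted by the visits to `(b, h)`. By a Pinsker type
inequality (`sum_mul_log_sub_log_le`) the row realizing `D` contributes a multiple of `D ^ 2` times
its visits. Hence `D` is at most a constant times the largest score divided by the smallest number of
visits.

*Probabilistic part*. Both quantities are controlled by one Azuma–Hoeffding inequality for additive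
functionals of a finite Markov chain (`IsMarkovChain.measureReal_le_transitionSum`). The scores are
martingales up to a boundary term (`IsMarkovChain.measureReal_le_abs_sum`). The number of visits to
`x` is at least `T δ₀ / 2` with high probability, because the truncated potential
`g = ∑_{j < N₀} Q ^ j 1ₓ` satisfies `g - Q g = 1ₓ - Q ^ N₀ 1ₓ ≤ 1ₓ - δ₀` and takes values in `[0, N₀]`
(`IsMarkovChain.measureReal_visits_lt`). That the triples form a Markov chain with the transition
matrix `tripleTransition` is `IsBehaviorProcess.isMarkovChain`.

The union bound over the triples has a prefactor larger than `2`. A large constant `C₁` in the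
statement makes up for it: whenever the claimed bound is smaller than `1`, the exponent obtained
here exceeds the claimed one by enough to absorb the prefactor (`le_two_mul_exp_of_le`).
-/

/-! ### Concentration for finite Markov chains -/

/-- `z` is a Markov chain with transition matrix `Q` relative to the filtration `𝒢`. The Markov
property is stated in integrated form, against bounded `𝒢 t`-measurable test functions, so that
no regular conditional law is needed. -/
structure IsMarkovChain {S Z : Type*} {mS : MeasurableSpace S} [MeasurableSpace Z]
    (Q : Matrix Z Z ℝ) (μ : Measure S) (𝒢 : Filtration ℕ mS) (z : ℕ → S → Z) : Prop where
  adapted : ∀ t, Measurable[𝒢 t] (z t)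
  transition : ∀ (t : ℕ) (x : Z) (F : S → ℝ), Measurable[𝒢 t] F → (∃ C, ∀ s, |F s| ≤ C) →
    ∫ s, (z (t + 1) ⁻¹' {x}).indicator F s ∂μ = ∫ s, F s * Q (z t s) x ∂μ

/-- The additive functional `∑_{t < T} φ (z t, z (t + 1))` of the path `z`. -/
def transitionSum {S Z : Type*} (φ : Z → Z → ℝ) (z : ℕ → S → Z) (T : ℕ) (s : S) : ℝ :=
  ∑ t ∈ Finset.range T, φ (z t s) (z (t + 1) s)

lemma abs_transitionSum_le {S Z : Type*} {φ : Z → Z → ℝ} (hφ : ∀ x y, |φ x y| ≤ 1)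
    (z : ℕ → S → Z) (T : ℕ) (s : S) : |transitionSum φ z T s| ≤ T := by
  refine (Finset.abs_sum_le_sum_abs _ _).trans ?_
  refine (Finset.sum_le_sum fun t _ => hφ _ _).trans ?_
  simp

/-- Hoeffding's lemma for a finite distribution `q` on `[-1, 1]`-valued centred data. -/
lemma sum_mul_exp_le_of_centered {Z : Type*} [Fintype Z] {q f : Z → ℝ} (hq : ∀ y, 0 ≤ q y)
    (hq1 : ∑ y, q y = 1) (hf : ∀ y, |f y| ≤ 1) (h0 : ∑ y, q y * f y = 0) (r : ℝ) :
    ∑ y, q y * Real.exp (r * f y) ≤ Real.exp (r ^ 2 / 2) := by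
  calc ∑ y, q y * Real.exp (r * f y)
      ≤ ∑ y, (q y * Real.cosh r + q y * f y * Real.sinh r) := by
        refine Finset.sum_le_sum fun y _ => ?_
        have := Real.exp_mul_le_cosh_add_mul_sinh (hf y) r
        rw [mul_comm r, mul_assoc, ← mul_add]
        exact mul_le_mul_of_nonneg_left this (hq y)
    _ = Real.cosh r := by
        rw [Finset.sum_add_distrib, ← Finset.sum_mul, ← Finset.sum_mul, hq1, h0]; ring
    _ ≤ _ := Real.cosh_le_exp_half_sq r

namespace IsMarkovChain

variable {S Z : Type*} {mS : MeasurableSpace S} [MeasurableSpace Z] [MeasurableSingletonClass Z]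
  [Fintype Z] {Q : Matrix Z Z ℝ} {μ : Measure S} {𝒢 : Filtration ℕ mS} {z : ℕ → S → Z}

lemma measurable_transitionSum (hz : IsMarkovChain Q μ 𝒢 z) (φ : Z → Z → ℝ) (T : ℕ) :
    Measurable[𝒢 T] (transitionSum φ z T) := by
  have hadapt : ∀ t ≤ T, Measurable[𝒢 T] (z t) := fun t ht => (hz.adapted t).mono (𝒢.mono ht) le_rfl
  unfold transitionSum
  refine Finset.measurable_fun_sum _ fun t ht => ?_
  have ht := Finset.mem_range.1 ht
  exact (measurable_of_finite fun p : Z × Z => φ p.1 p.2).comp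
    ((hadapt t ht.le).prodMk (hadapt (t + 1) ht))

variable [DecidableEq Z] [IsProbabilityMeasure μ]

/-- The exponential moment bound behind the Azuma–Hoeffding inequality: if `φ x` is centred under
every row `Q x`, the functional `transitionSum φ z` is a martingale with increments in `[-1, 1]`. -/
lemma integral_exp_transitionSum_le (hz : IsMarkovChain Q μ 𝒢 z)
    (hQ : Q ∈ Matrix.rowStochastic ℝ Z) {φ : Z → Z → ℝ} (hφ : ∀ x y, |φ x y| ≤ 1)
    (h0 : ∀ x, ∑ y, Q x y * φ x y = 0) (r : ℝ) (T : ℕ) :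
    ∫ s, Real.exp (r * transitionSum φ z T s) ∂μ ≤ Real.exp (T * (r ^ 2 / 2)) := by
  have hbound : ∀ T s, Real.exp (r * transitionSum φ z T s) ≤ Real.exp (|r| * T) := fun T s => by
    refine Real.exp_le_exp.2 ((le_abs_self _).trans ?_)
    rw [abs_mul]
    exact mul_le_mul_of_nonneg_left (abs_transitionSum_le hφ z T s) (abs_nonneg r)
  have hmeas : ∀ T, Measurable[𝒢 T] fun s => Real.exp (r * transitionSum φ z T s) := fun T =>
    Real.measurable_exp.comp ((hz.measurable_transitionSum φ T).const_mul r)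
  have hzm : ∀ t, Measurable (z t) := fun t => (hz.adapted t).mono (𝒢.le t) le_rfl
  induction T with
  | zero => simp [transitionSum]
  | succ T ih =>
    set E : S → ℝ := fun s => Real.exp (r * transitionSum φ z T s) with hE
    have hEm : Measurable[𝒢 T] E := hmeas T
    have hEpos : ∀ s, 0 ≤ E s := fun s => (Real.exp_pos _).le
    have hrow : ∀ x, ∑ y, Q x y * Real.exp (r * φ x y) ≤ Real.exp (r ^ 2 / 2) := fun x =>
      sum_mul_exp_le_of_centered (fun y => hQ.1 x y)
        (Matrix.sum_row_of_mem_rowStochastic hQ x) (hφ x) (h0 x) r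
    let F : Z → S → ℝ := fun y s => E s * Real.exp (r * φ (z T s) y)
    have hFm : ∀ y, Measurable[𝒢 T] (F y) := fun y =>
      hEm.mul ((measurable_of_finite fun x => Real.exp (r * φ x y)).comp (hz.adapted T))
    have hFb : ∀ y s, |F y s| ≤ Real.exp (|r| * T) * Real.exp |r| := fun y s => by
      rw [abs_mul, abs_of_nonneg (hEpos s), Real.abs_exp]
      refine mul_le_mul (hbound T s) (Real.exp_le_exp.2 ((le_abs_self _).trans ?_))
        (Real.exp_pos _).le (Real.exp_pos _).le
      rw [abs_mul]
      exact mul_le_of_le_one_right (abs_nonneg r) (hφ _ _)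
    have hFint : ∀ y, Integrable (F y) μ := fun y =>
      Integrable.of_bound ((hFm y).mono (𝒢.le T) le_rfl).aestronglyMeasurable _
        (Eventually.of_forall (hFb y))
    have hQb : ∀ y, Integrable (fun s => F y s * Q (z T s) y) μ := fun y => by
      have hm : Measurable fun s => Q (z T s) y := (measurable_of_finite fun x => Q x y).comp (hzm T)
      refine (hFint y).mul_bdd (c := 1) hm.aestronglyMeasurable (Eventually.of_forall fun s => ?_)
      rw [Real.norm_of_nonneg (hQ.1 _ _)]
      exact Matrix.le_one_of_mem_rowStochastic hQ
    calc ∫ s, Real.exp (r * transitionSum φ z (T + 1) s) ∂μ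
        = ∫ s, ∑ y, (z (T + 1) ⁻¹' {y}).indicator (F y) s ∂μ := by
          refine integral_congr_ae (Eventually.of_forall fun s => ?_)
          dsimp only
          rw [Finset.sum_eq_single (z (T + 1) s)]
          · simp only [Set.indicator, Set.mem_preimage, Set.mem_singleton_iff, if_true, F, hE]
            rw [transitionSum, Finset.sum_range_succ, mul_add, Real.exp_add, transitionSum]
          · intro y _ hy
            exact Set.indicator_of_notMem (fun h => hy h.symm) _
          · simp
      _ = ∑ y, ∫ s, F y s * Q (z T s) y ∂μ := by
          rw [integral_finsetSum _ fun y _ =>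
            (hFint y).indicator (hzm (T + 1) (measurableSet_singleton y))]
          exact Finset.sum_congr rfl fun y _ => hz.transition T y (F y) (hFm y) ⟨_, hFb y⟩
      _ = ∫ s, E s * ∑ y, Q (z T s) y * Real.exp (r * φ (z T s) y) ∂μ := by
          rw [← integral_finsetSum _ fun y _ => hQb y]
          refine integral_congr_ae (Eventually.of_forall fun s => ?_)
          simp only [F, Finset.mul_sum]
          exact Finset.sum_congr rfl fun y _ => by ring
      _ ≤ ∫ s, E s * Real.exp (r ^ 2 / 2) ∂μ := by
          refine integral_mono_of_nonneg (Eventually.of_forall fun s => ?_)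
            (Integrable.mul_const ?_ _) (Eventually.of_forall fun s => ?_)
          · exact mul_nonneg (hEpos s) (Finset.sum_nonneg fun y _ =>
              mul_nonneg (hQ.1 _ _) (Real.exp_pos _).le)
          · refine Integrable.of_bound (hEm.mono (𝒢.le T) le_rfl).aestronglyMeasurable
              (Real.exp (|r| * T)) (Eventually.of_forall fun s => ?_)
            rw [Real.norm_of_nonneg (hEpos s)]
            exact hbound T s
          · exact mul_le_mul_of_nonneg_left (hrow _) (hEpos s)
      _ ≤ Real.exp ((T + 1 : ℕ) * (r ^ 2 / 2)) := by
          rw [integral_mul_const, Nat.cast_succ, add_mul, Real.exp_add, one_mul]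
          exact mul_le_mul_of_nonneg_right ih (Real.exp_pos _).le

/-- The Azuma–Hoeffding inequality for additive functionals of a finite Markov chain. -/
lemma measureReal_le_transitionSum (hz : IsMarkovChain Q μ 𝒢 z)
    (hQ : Q ∈ Matrix.rowStochastic ℝ Z) {φ : Z → Z → ℝ} (hφ : ∀ x y, |φ x y| ≤ 1)
    (h0 : ∀ x, ∑ y, Q x y * φ x y = 0) {T : ℕ} (hT : 0 < T) {x : ℝ} (hx : 0 ≤ x) :
    μ.real {s | x ≤ transitionSum φ z T s} ≤ Real.exp (-(x ^ 2 / (2 * T))) := by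
  have hT' : (0 : ℝ) < T := by exact_mod_cast hT
  -- `r = x / T` minimises the exponent `-r x + T r² / 2`.
  have hr : 0 ≤ x / T := by positivity
  have hm : Measurable (transitionSum φ z T) :=
    (hz.measurable_transitionSum φ T).mono (𝒢.le T) le_rfl
  have hint : Integrable (fun s => Real.exp (x / T * transitionSum φ z T s)) μ := by
    refine Integrable.of_bound (Real.measurable_exp.comp (hm.const_mul _)).aestronglyMeasurable
      (Real.exp (x / T * T)) (Eventually.of_forall fun s => ?_)
    rw [Real.norm_of_nonneg (Real.exp_pos _).le]
    exact Real.exp_le_exp.2 (mul_le_mul_of_nonneg_left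
      ((le_abs_self _).trans (abs_transitionSum_le hφ z T s)) hr)
  refine (measure_ge_le_exp_mul_mgf x hr hint).trans ?_
  refine (mul_le_mul_of_nonneg_left (hz.integral_exp_transitionSum_le hQ hφ h0 (x / T) T)
    (Real.exp_pos _).le).trans (le_of_eq ?_)
  rw [← Real.exp_add]
  congr 1
  field_simp
  ring

end IsMarkovChain

/-- The number of visits of the path `z` to the state `x` before time `T`. -/
def visits {S Z : Type*} [DecidableEq Z] (z : ℕ → S → Z) (T : ℕ) (x : Z) (s : S) : ℝ :=
  ∑ t ∈ Finset.range T, if z t s = x then 1 else 0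

/-- Grouping the times `t < T` by the state `z t`. -/
lemma sum_range_comp_eq_sum_visits_mul {S Z : Type*} [Fintype Z] [DecidableEq Z] (z : ℕ → S → Z)
    (T : ℕ) (f : Z → ℝ) (s : S) :
    ∑ t ∈ Finset.range T, f (z t s) = ∑ x, visits z T x s * f x := by
  simp only [visits, Finset.sum_mul, ite_mul, one_mul, zero_mul]
  rw [Finset.sum_comm]
  exact Finset.sum_congr rfl fun t _ => by simp

namespace IsMarkovChain

variable {S Z : Type*} {mS : MeasurableSpace S} [MeasurableSpace Z] [MeasurableSingletonClass Z]
  [Fintype Z] {Q : Matrix Z Z ℝ} {μ : Measure S} {𝒢 : Filtration ℕ mS} {z : ℕ → S → Z}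
  [DecidableEq Z] [IsProbabilityMeasure μ]

/-- Two-sided concentration of `∑_{t < T} ξ (z t)` for a function `ξ` centred under every row. The
factor `8` rather than `2` absorbs the first summand, which is not a martingale increment. -/
lemma measureReal_le_abs_sum (hz : IsMarkovChain Q μ 𝒢 z)
    (hQ : Q ∈ Matrix.rowStochastic ℝ Z) {ξ : Z → ℝ} (hξ : ∀ y, |ξ y| ≤ 1)
    (h0 : ∀ x, ∑ y, Q x y * ξ y = 0) {T : ℕ} (hT : 0 < T) {a : ℝ} (ha : 4 ≤ a) :
    μ.real {s | a ≤ |∑ t ∈ Finset.range T, ξ (z t s)|} ≤ 2 * Real.exp (-(a ^ 2 / (8 * T))) := by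
  have key : ∀ ζ : Z → ℝ, (∀ y, |ζ y| ≤ 1) → (∀ x, ∑ y, Q x y * ζ y = 0) →
      μ.real {s | a ≤ ∑ t ∈ Finset.range T, ζ (z t s)} ≤ Real.exp (-(a ^ 2 / (8 * T))) := by
    intro ζ hζ h0
    have h := hz.measureReal_le_transitionSum hQ (φ := fun _ y => ζ y) (fun _ => hζ) h0 hT
      (x := a / 2) (by linarith)
    refine (measureReal_mono fun s hs => ?_).trans (h.trans (le_of_eq ?_))
    · have hs : a ≤ ∑ t ∈ Finset.range T, ζ (z t s) := hs
      have hshift : transitionSum (fun _ y => ζ y) z T s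
          = ∑ t ∈ Finset.range T, ζ (z t s) + ζ (z T s) - ζ (z 0 s) := by
        rw [← Finset.sum_range_succ (fun t => ζ (z t s)), Finset.sum_range_succ', transitionSum]
        ring
      have h1 := abs_le.1 (hζ (z T s))
      have h2 := abs_le.1 (hζ (z 0 s))
      show a / 2 ≤ transitionSum (fun _ y => ζ y) z T s
      rw [hshift]
      linarith
    · congr 2
      field_simp
      ring
  have h1 := key ξ hξ h0
  have h2 := key (fun y => -ξ y) (fun y => by rw [abs_neg]; exact hξ y)
    (fun x => by simp [h0 x])
  simp only [Finset.sum_neg_distrib] at h2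
  have hsub : {s | a ≤ |∑ t ∈ Finset.range T, ξ (z t s)|} ⊆
      {s | a ≤ ∑ t ∈ Finset.range T, ξ (z t s)} ∪ {s | a ≤ -∑ t ∈ Finset.range T, ξ (z t s)} :=
    fun s (hs : a ≤ |∑ t ∈ Finset.range T, ξ (z t s)|) => le_abs.1 hs
  linarith [(measureReal_mono (μ := μ) hsub).trans (measureReal_union_le _ _)]

/-- A chain all of whose `N`-step probabilities of reaching `x` are at least `δ` visits `x` at least
`T δ / 2` times, up to an exponentially small probability. The martingale is the one attached to the
truncated potential `g = ∑_{j < N} Q ^ j 1ₓ`, for which `g - Q g = 1ₓ - Q ^ N 1ₓ`. -/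
lemma measureReal_visits_lt (hz : IsMarkovChain Q μ 𝒢 z)
    (hQ : Q ∈ Matrix.rowStochastic ℝ Z) {N : ℕ} (hN : 0 < N) {δ : ℝ} {x : Z}
    (hδ : ∀ y, δ ≤ (Q ^ N) y x) {T : ℕ} (hT : 0 < T) (hTN : 4 * N ≤ T * δ) :
    μ.real {s | visits z T x s < T * δ / 2} ≤ Real.exp (-(T * δ ^ 2 / (32 * N ^ 2))) := by
  have hN' : (0 : ℝ) < N := by exact_mod_cast hN
  have hT' : (0 : ℝ) < T := by exact_mod_cast hT
  have hpow : ∀ j, Q ^ j ∈ Matrix.rowStochastic ℝ Z := fun j => pow_mem hQ j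
  set g : Z → ℝ := fun y => ∑ j ∈ Finset.range N, (Q ^ j) y x with hg
  set g' : Z → ℝ := fun y => ∑ j ∈ Finset.range N, (Q ^ (j + 1)) y x with hg'
  have hQg : ∀ y, ∑ y', Q y y' * g y' = g' y := fun y => by
    simp only [hg, hg', Finset.mul_sum]
    rw [Finset.sum_comm]
    exact Finset.sum_congr rfl fun j _ => by rw [pow_succ', Matrix.mul_apply]
  have hrange : ∀ k y, 0 ≤ ∑ j ∈ Finset.range N, (Q ^ (j + k)) y x ∧
      ∑ j ∈ Finset.range N, (Q ^ (j + k)) y x ≤ N := fun k y =>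
    ⟨Finset.sum_nonneg fun j _ => (hpow _).1 _ _, by
      refine (Finset.sum_le_sum fun j _ =>
        Matrix.le_one_of_mem_rowStochastic (hpow (j + k))).trans ?_
      simp⟩
  have hg01 : ∀ y, 0 ≤ g y ∧ g y ≤ N := hrange 0
  have hg'01 : ∀ y, 0 ≤ g' y ∧ g' y ≤ N := hrange 1
  have htel : ∀ y, g' y - g y = (Q ^ N) y x - if y = x then 1 else 0 := fun y => by
    rw [hg, hg', ← Finset.sum_sub_distrib, Finset.sum_range_sub fun j => (Q ^ j) y x, pow_zero,
      Matrix.one_apply]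
  have h := hz.measureReal_le_transitionSum hQ (φ := fun y y' => (g' y - g y') / N)
    (fun y y' => by
      rw [abs_div, abs_of_pos hN', div_le_one hN', abs_le]
      constructor <;> linarith [hg01 y', hg'01 y])
    (fun y => by
      simp only [mul_div_assoc', mul_sub, ← Finset.sum_div, Finset.sum_sub_distrib, hQg,
        ← Finset.sum_mul, Matrix.sum_row_of_mem_rowStochastic hQ y]
      simp) hT (x := T * δ / (4 * N)) (div_nonneg (by linarith) (by linarith))
  refine (measureReal_mono fun s hs => ?_).trans (h.trans (le_of_eq ?_))
  · have hs : visits z T x s < T * δ / 2 := hs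
    have hsum : N * transitionSum (fun y y' => (g' y - g y') / N) z T s
        = ∑ t ∈ Finset.range T, (g' (z t s) - g (z t s)) + (g (z 0 s) - g (z T s)) := by
      rw [← neg_sub (g (z T s)), ← Finset.sum_range_sub fun t => g (z t s), transitionSum,
        Finset.mul_sum, ← sub_eq_add_neg, ← Finset.sum_sub_distrib]
      exact Finset.sum_congr rfl fun t _ => by field_simp; ring
    have hlow : T * δ - visits z T x s ≤ ∑ t ∈ Finset.range T, (g' (z t s) - g (z t s)) := by
      simp only [htel, Finset.sum_sub_distrib]
      refine sub_le_sub_right ?_ _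
      simpa using Finset.sum_le_sum fun t (_ : t ∈ Finset.range T) => hδ (z t s)
    show T * δ / (4 * N) ≤ _
    rw [div_le_iff₀ (by positivity)]
    have := (hg01 (z 0 s)).1
    have := (hg01 (z T s)).2
    nlinarith
  · congr 2
    field_simp
    ring

end IsMarkovChain

/-! ### The chain of triples of a behavior process -/

lemma tripleTransition_mem_rowStochastic {B H U : Type*} [Fintype B] [Fintype H] [DecidableEq B]
    [DecidableEq H] [MeasurableSpace H] [MeasurableSingletonClass H] [MeasurableSpace U]
    {M : H → B → B → ℝ} (hM0 : ∀ h b c, 0 ≤ M h b c) (hM1 : ∀ h b, ∑ c, M h b c = 1)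
    {sig : B → U → H} (hsig : ∀ b, Measurable (sig b)) (ν : Measure U) [IsProbabilityMeasure ν] :
    tripleTransition M sig ν ∈ Matrix.rowStochastic ℝ (B × B × H) := by
  refine Matrix.mem_rowStochastic_iff_sum.2 ⟨fun x y => ?_, fun x => ?_⟩
  · unfold tripleTransition
    split_ifs
    exacts [mul_nonneg measureReal_nonneg (hM0 _ _ _), le_rfl]
  · have hν : ∑ h, ν.real {v | sig x.1 v = h} = 1 := by
      have h := sum_measureReal_preimage_singleton (μ := ν) Finset.univ (f := sig x.1)
        fun h _ => hsig x.1 (measurableSet_singleton h)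
      simpa [Set.preimage] using h
    simp only [tripleTransition, Fintype.sum_prod_type]
    rw [Finset.sum_comm]
    simp only [Finset.sum_ite_irrel, Finset.sum_const_zero, Finset.sum_ite_eq', Finset.mem_univ,
      if_true]
    rw [Finset.sum_comm]
    simpa [← Finset.mul_sum, hM1] using hν

section BehaviorChain

variable {S B H U : Type*} {mS : MeasurableSpace S} [MeasurableSpace B] [MeasurableSpace U]

/-- The filtration of the chain of triples: at time `t`, the behaviors up to time `t + 1` and the
users up to time `t`. -/
def tripleFiltration {b : ℕ → S → B} {u : ℕ → S → U} (hb : ∀ t, Measurable (b t))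
    (hu : ∀ t, Measurable (u t)) : Filtration ℕ mS where
  seq t := preUserHistory b u (t + 1)
  mono' s t hst := sup_le_sup (biSup_mono fun i (hi : i ≤ s + 1) => hi.trans (by gcongr))
    (biSup_mono fun i (hi : i < s + 1) => hi.trans_le (by gcongr))
  le' t := sup_le (iSup₂_le fun i _ => (hb i).comap_le) (iSup₂_le fun i _ => (hu i).comap_le)

lemma measurable_behavior_preUserHistory (b : ℕ → S → B) (u : ℕ → S → U) {i t : ℕ} (h : i ≤ t) :
    Measurable[preUserHistory b u t] (b i) :=
  measurable_iff_comap_le.2 (le_sup_of_le_left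
    (le_iSup₂_of_le (f := fun i (_ : i ∈ Set.Iic t) => MeasurableSpace.comap (b i) inferInstance)
      i h le_rfl))

lemma measurable_user_preUserHistory (b : ℕ → S → B) (u : ℕ → S → U) {i t : ℕ} (h : i < t) :
    Measurable[preUserHistory b u t] (u i) :=
  measurable_iff_comap_le.2 (le_sup_of_le_right
    (le_iSup₂_of_le (f := fun i (_ : i ∈ Set.Iio t) => MeasurableSpace.comap (u i) inferInstance)
      i h le_rfl))

lemma comap_sup_comap_le_history (b : ℕ → S → B) (u : ℕ → S → U) {i t : ℕ} (h : i ≤ t) :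
    MeasurableSpace.comap (b i) inferInstance ⊔ MeasurableSpace.comap (u i) inferInstance ≤
      history b u t :=
  le_iSup₂_of_le (f := fun i (_ : i ∈ Set.Iic t) => MeasurableSpace.comap (b i) inferInstance ⊔
    MeasurableSpace.comap (u i) inferInstance) i h le_rfl

lemma preUserHistory_le_history (b : ℕ → S → B) (u : ℕ → S → U) (t : ℕ) :
    preUserHistory b u t ≤ history b u t :=
  sup_le (iSup₂_le fun _ hi => le_sup_left.trans (comap_sup_comap_le_history b u hi))
    (iSup₂_le fun _ hi => le_sup_right.trans
      (comap_sup_comap_le_history b u (Set.mem_Iio.1 hi).le))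

lemma measurable_user_history (b : ℕ → S → B) (u : ℕ → S → U) (t : ℕ) :
    Measurable[history b u t] (u t) :=
  measurable_iff_comap_le.2 (le_sup_right.trans (comap_sup_comap_le_history b u le_rfl))

lemma history_le {b : ℕ → S → B} {u : ℕ → S → U} (hb : ∀ t, Measurable (b t))
    (hu : ∀ t, Measurable (u t)) (t : ℕ) : history b u t ≤ mS :=
  iSup₂_le fun i _ => sup_le (hb i).comap_le (hu i).comap_le

variable [MeasurableSpace H] [MeasurableSingletonClass B] [MeasurableSingletonClass H]
  [Finite B] [DecidableEq B]

/-- The triples `(b (t + 1), b t, h t)` of a behavior process form a Markov chain: the user of time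
`t + 1` is integrated out by independence, and the behavior of time `t + 2` by conditioning on the
history. -/
lemma IsBehaviorProcess.isMarkovChain {M : H → B → B → ℝ} {sig : B → U → H} {ν : Measure U}
    {μ : Measure S} [IsProbabilityMeasure μ] {b : ℕ → S → B} {u : ℕ → S → U}
    (hsig : ∀ b, Measurable (sig b)) (hp : IsBehaviorProcess M sig ν μ b u) :
    IsMarkovChain (tripleTransition M sig ν) μ
      (tripleFiltration hp.measurable_behavior hp.measurable_user)
      (fun t s => (b (t + 1) s, b t s, sig (b t s) (u t s))) where
  adapted t := by
    have h1 : Measurable fun p : B × U => sig p.1 p.2 := measurable_from_prod_countable_right hsig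
    have hb := measurable_behavior_preUserHistory b u t.le_succ
    exact (measurable_behavior_preUserHistory b u le_rfl).prodMk (hb.prodMk
      (h1.comp (hb.prodMk (measurable_user_preUserHistory b u t.lt_succ_self))))
  transition t x F hF hFb := by
    obtain ⟨c, c', g⟩ := x
    obtain ⟨C, hC⟩ := hFb
    have hF : Measurable[preUserHistory b u (t + 1)] F := hF
    have hbm := hp.measurable_behavior
    have hum := hp.measurable_user
    set D : Set S := b (t + 1) ⁻¹' {c'} with hD
    set W : Set U := sig c' ⁻¹' {g} with hW
    set V : Set S := u (t + 1) ⁻¹' W with hV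
    set E : Set S := b (t + 1 + 1) ⁻¹' {c} with hE
    have hWm : MeasurableSet W := hsig c' (measurableSet_singleton g)
    have hDm : MeasurableSet[preUserHistory b u (t + 1)] D :=
      measurable_behavior_preUserHistory b u le_rfl (measurableSet_singleton c')
    have hVm : MeasurableSet[history b u (t + 1)] V := measurable_user_history b u (t + 1) hWm
    have hle := preUserHistory_le_history b u (t + 1)
    have hhist := history_le hbm hum (t + 1)
    have hEm : MeasurableSet E := hbm _ (measurableSet_singleton c)
    set G : S → ℝ := (V ∩ D).indicator F with hG
    have hGm : Measurable[history b u (t + 1)] G :=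
      (hF.mono hle le_rfl).indicator (hVm.inter (hle _ hDm))
    have hGb : ∀ s, ‖G s‖ ≤ C := fun s =>
      (norm_indicator_le_norm_self _ _).trans (hC s)
    have hEint : Integrable (E.indicator fun _ => (1 : ℝ)) μ :=
      (integrable_const _).indicator hEm
    have hGE : Integrable (G * E.indicator fun _ => (1 : ℝ)) μ :=
      hEint.bdd_mul (hGm.mono hhist le_rfl).aestronglyMeasurable (Eventually.of_forall hGb)
    have hcond : μ[G * E.indicator (fun _ => (1 : ℝ)) | history b u (t + 1)]
        =ᵐ[μ] fun s => G s * M g c' c := by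
      refine (condExp_mul_of_stronglyMeasurable_left hGm.stronglyMeasurable hGE hEint).trans ?_
      filter_upwards [hp.markov (t + 1) c] with s hs
      rw [Pi.mul_apply, hs]
      by_cases h : s ∈ V ∩ D
      · have h2 : b (t + 1) s = c' := h.2
        have h1 : sig c' (u (t + 1) s) = g := h.1
        rw [h2, h1]
      · simp [hG, Set.indicator_of_notMem h]
    have hindep : ∫ s in V, D.indicator F s ∂μ = μ.real V * ∫ s, D.indicator F s ∂μ := by
      have hDF : Measurable[preUserHistory b u (t + 1)] (D.indicator F) := hF.indicator hDm
      refine Indep.setIntegral_eq_mul (f := id) (hum (t + 1)).comap_le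
        (indep_of_indep_of_le_right (hp.indep_user (t + 1)) hDF.comap_le)
        (hDF.mono (hle.trans hhist) le_rfl).aemeasurable ⟨W, hWm, rfl⟩
        measurable_id.aestronglyMeasurable
    have hVν : μ.real V = ν.real W := by
      rw [← hp.law_user (t + 1), map_measureReal_apply (hum _) hWm]
    calc ∫ s, ((fun s => (b (t + 1 + 1) s, b (t + 1) s, sig (b (t + 1) s) (u (t + 1) s))) ⁻¹'
            {(c, c', g)}).indicator F s ∂μ
        = ∫ s, (G * E.indicator fun _ => (1 : ℝ)) s ∂μ := by
          refine integral_congr_ae (Eventually.of_forall fun s => ?_)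
          have hiff : (s ∈ (fun s => (b (t + 1 + 1) s, b (t + 1) s,
              sig (b (t + 1) s) (u (t + 1) s))) ⁻¹' {(c, c', g)}) ↔ s ∈ (V ∩ D) ∩ E := by
            simp only [hD, hV, hE, hW, Set.mem_preimage, Set.mem_singleton_iff, Prod.mk.injEq,
              Set.mem_inter_iff]
            constructor
            · rintro ⟨h1, h2, h3⟩
              exact ⟨⟨h2 ▸ h3, h2⟩, h1⟩
            · rintro ⟨⟨h3, h2⟩, h1⟩
              exact ⟨h1, h2, h2.symm ▸ h3⟩
          simp only [Set.indicator, hiff, hG, Pi.mul_apply, Set.mem_inter_iff]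
          split_ifs <;> simp_all
      _ = ∫ s, G s * M g c' c ∂μ := by
          rw [← integral_condExp hhist]
          exact integral_congr_ae hcond
      _ = ν.real W * M g c' c * ∫ s, D.indicator F s ∂μ := by
          rw [integral_mul_const, hG, ← Set.indicator_indicator,
            integral_indicator (hhist _ hVm), hindep, hVν]
          ring
      _ = ∫ s, F s * tripleTransition M sig ν (b (t + 1) s, b t s, sig (b t s) (u t s))
            (c, c', g) ∂μ := by
          rw [← integral_const_mul]
          refine integral_congr_ae (Eventually.of_forall fun s => ?_)
          by_cases h : b (t + 1) s = c'
          · simp [tripleTransition, Set.indicator, hD, h, hW, Set.preimage]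
            ring
          · simp [tripleTransition, Set.indicator, hD, h, Ne.symm h]

end BehaviorChain

/-! ### The likelihood inequality -/

/-- A weak form of Pinsker's inequality, through the Hellinger distance
`∑ (√p - √q)² ≤ KL(p ‖ q)`. -/
lemma sum_mul_log_sub_log_le {B : Type*} [Fintype B] {p q : B → ℝ} (hp : ∀ c, 0 < p c)
    (hq : ∀ c, 0 < q c) (hp1 : ∑ c, p c = 1) (hq1 : ∑ c, q c = 1) :
    4 * Fintype.card B * ∑ c, p c * (Real.log (q c) - Real.log (p c)) ≤
      -(∑ c, |q c - p c|) ^ 2 := by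
  have hp2 : ∀ c, √(p c) ^ 2 = p c := fun c => Real.sq_sqrt (hp c).le
  have hq2 : ∀ c, √(q c) ^ 2 = q c := fun c => Real.sq_sqrt (hq c).le
  have hhell : ∑ c, p c * (Real.log (q c) - Real.log (p c)) ≤ -∑ c, (√(q c) - √(p c)) ^ 2 := by
    have h1 : ∀ c, p c * (Real.log (q c) - Real.log (p c)) ≤ 2 * (√(p c) * √(q c) - p c) := by
      intro c
      have hsp := Real.sqrt_pos.2 (hp c)
      have hsq := Real.sqrt_pos.2 (hq c)
      have hlog : Real.log (q c) - Real.log (p c) ≤ 2 * (√(q c) / √(p c) - 1) := by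
        have := Real.log_le_sub_one_of_pos (div_pos hsq hsp)
        rw [Real.log_div hsq.ne' hsp.ne', Real.log_sqrt (hq c).le, Real.log_sqrt (hp c).le] at this
        linarith
      refine (mul_le_mul_of_nonneg_left hlog (hp c).le).trans (le_of_eq ?_)
      have : p c * (√(q c) / √(p c)) = √(p c) * √(q c) := by
        nth_rewrite 1 [← hp2 c]
        field_simp
      linear_combination 2 * this
    refine (Finset.sum_le_sum fun c _ => h1 c).trans (le_of_eq ?_)
    have h2 : ∀ c, (√(q c) - √(p c)) ^ 2 = q c + p c - 2 * (√(p c) * √(q c)) := fun c => by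
      rw [← hp2 c, ← hq2 c, Real.sqrt_sq (Real.sqrt_nonneg _), Real.sqrt_sq (Real.sqrt_nonneg _)]
      ring
    simp only [h2, ← Finset.mul_sum, Finset.sum_sub_distrib, Finset.sum_add_distrib, hp1, hq1]
    ring
  have hl1 : (∑ c, |q c - p c|) ^ 2 ≤ 4 * Fintype.card B * ∑ c, (√(q c) - √(p c)) ^ 2 := by
    refine (sq_sum_le_card_mul_sum_sq (s := Finset.univ)).trans ?_
    rw [mul_comm (4 : ℝ), mul_assoc, Finset.card_univ, Finset.mul_sum _ _ (4 : ℝ)]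
    refine mul_le_mul_of_nonneg_left (Finset.sum_le_sum fun c _ => ?_) (by positivity)
    have hle : ∀ r : B → ℝ, (∀ c, 0 < r c) → ∑ c, r c = 1 → √(r c) ≤ 1 := fun r hr hr1 => by
      refine Real.sqrt_le_one.2 ?_
      rw [← hr1]
      exact Finset.single_le_sum (fun i _ => (hr i).le) (Finset.mem_univ c)
    have hfac : q c - p c = (√(q c) - √(p c)) * (√(q c) + √(p c)) := by
      linear_combination hp2 c - hq2 c
    rw [sq_abs, hfac, mul_pow, mul_comm]
    refine mul_le_mul_of_nonneg_right ?_ (sq_nonneg _)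
    have := hle p hp hp1
    have := hle q hq hq1
    nlinarith [Real.sqrt_nonneg (p c), Real.sqrt_nonneg (q c)]
  have hcard : (0 : ℝ) ≤ 4 * Fintype.card B := by positivity
  nlinarith [mul_le_mul_of_nonneg_left hhell hcard]

lemma abs_log_sub_log_le {x y p : ℝ} (hp : 0 < p) (hx : p ≤ x) (hy : p ≤ y) :
    |Real.log x - Real.log y| ≤ |x - y| / p := by
  have key : ∀ x y : ℝ, p ≤ x → p ≤ y → Real.log x - Real.log y ≤ |x - y| / p := by
    intro x y hx hy
    have hx0 := hp.trans_le hx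
    have hy0 := hp.trans_le hy
    have h := Real.log_le_sub_one_of_pos (div_pos hx0 hy0)
    rw [Real.log_div hx0.ne' hy0.ne'] at h
    calc _ ≤ x / y - 1 := h
      _ = (x - y) / y := by field_simp
      _ ≤ |x - y| / y := div_le_div_of_nonneg_right (le_abs_self _) hy0.le
      _ ≤ |x - y| / p := div_le_div_of_nonneg_left (abs_nonneg _) hp hy
  refine abs_le.2 ⟨?_, key x y hx hy⟩
  have := key y x hy hx
  rw [abs_sub_comm] at this
  linarith

/-- The deviation, at the observed triple `y = (b', b, h)`, of the indicator of the triple `x` from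
its conditional probability given `(b, h)` under the model `M`. -/
def score {B H : Type*} [DecidableEq B] [DecidableEq H] (M : H → B → B → ℝ) (x y : B × B × H) : ℝ :=
  (if y = x then 1 else 0) - if y.2 = x.2 then M x.2.2 x.2.1 x.1 else 0

section Model

variable {B H : Type*} [Fintype B] {M M' : H → B → B → ℝ}

lemma sum_abs_sub_le_modelDist [Finite H] (M M' : H → B → B → ℝ) (h : H) (b : B) :
    ∑ c, |M h b c - M' h b c| ≤ modelDist M M' :=
  le_ciSup (f := fun p : H × B => ∑ c, |M p.1 p.2 c - M' p.1 p.2 c|)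
    (Set.finite_range _).bddAbove (h, b)

lemma modelDist_le_two [Nonempty B] [Nonempty H] (hM0 : ∀ h b c, 0 ≤ M h b c)
    (hM1 : ∀ h b, ∑ c, M h b c = 1) (hM'0 : ∀ h b c, 0 ≤ M' h b c)
    (hM'1 : ∀ h b, ∑ c, M' h b c = 1) : modelDist M M' ≤ 2 := by
  refine ciSup_le fun p => ?_
  calc ∑ c, |M p.1 p.2 c - M' p.1 p.2 c| ≤ ∑ c, (M p.1 p.2 c + M' p.1 p.2 c) :=
        Finset.sum_le_sum fun c _ => abs_le.2 ⟨by linarith [hM0 p.1 p.2 c, hM'0 p.1 p.2 c],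
          by linarith [hM0 p.1 p.2 c, hM'0 p.1 p.2 c]⟩
    _ = 2 := by rw [Finset.sum_add_distrib, hM1, hM'1]; norm_num

variable [DecidableEq B] [DecidableEq H]

lemma abs_score_le_one (hM0 : ∀ h b c, 0 ≤ M h b c) (hM1 : ∀ h b, ∑ c, M h b c = 1)
    (x y : B × B × H) : |score M x y| ≤ 1 := by
  have h0 := hM0 x.2.2 x.2.1 x.1
  have h1 : M x.2.2 x.2.1 x.1 ≤ 1 := by
    rw [← hM1 x.2.2 x.2.1]
    exact Finset.single_le_sum (fun i _ => hM0 _ _ i) (Finset.mem_univ x.1)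
  unfold score
  rw [abs_le]
  split_ifs <;> constructor <;> linarith

lemma sum_tripleTransition_mul_score [Fintype H] {U : Type*} [MeasurableSpace U]
    (hM1 : ∀ h b, ∑ c, M h b c = 1) (sig : B → U → H) (ν : Measure U) (x x₀ : B × B × H) :
    ∑ y, tripleTransition M sig ν x₀ y * score M x y = 0 := by
  obtain ⟨c', b', h'⟩ := x
  rw [Fintype.sum_prod_type_right]
  refine Finset.sum_eq_zero fun y _ => ?_
  obtain ⟨b, h⟩ := y
  by_cases hb : b = x₀.1
  · by_cases hy : (b, h) = (b', h')
    · obtain ⟨rfl, rfl⟩ := Prod.mk.inj hy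
      simp only [tripleTransition, score, hb, if_true, mul_sub, Finset.sum_sub_distrib,
        Prod.mk.injEq, and_true, mul_ite, mul_one, mul_zero, Finset.sum_ite_eq', Finset.mem_univ,
        ← Finset.sum_mul, ← Finset.mul_sum, hM1]
      ring
    · simp [score, hy]
  · simp [tripleTransition, hb]

/-- If the likelihood of `M'` is at least that of `M`, all triples have been visited `v` times and
all total scores under `M` are at most `w`, then the distance of the models is at most a multiple of
`w / v`. The logarithm of the likelihood ratio is the sum of a part linear in the scores, which is
small, and of minus a sum of relative entropies, which is quadratic in the distance. -/
lemma visits_mul_modelDist_sq_le [Fintype H] [Nonempty B] [Nonempty H] {p : ℝ} (hp : 0 < p)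
    (hM0 : ∀ h b c, p ≤ M h b c) (hM1 : ∀ h b, ∑ c, M h b c = 1) (hM'0 : ∀ h b c, p ≤ M' h b c)
    (hM'1 : ∀ h b, ∑ c, M' h b c = 1) {S : Type*} {z : ℕ → S → B × B × H} {T : ℕ} {s : S}
    (hML : ∏ t ∈ Finset.range T, M (z t s).2.2 (z t s).2.1 (z t s).1 ≤
      ∏ t ∈ Finset.range T, M' (z t s).2.2 (z t s).2.1 (z t s).1)
    {v w : ℝ} (hv : ∀ x, v ≤ visits z T x s)
    (hw : ∀ x, |∑ t ∈ Finset.range T, score M x (z t s)| ≤ w) :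
    v * modelDist M' M ^ 2 ≤ 4 * Fintype.card B * (Fintype.card (B × B × H) * w *
      (modelDist M' M / p)) := by
  have hMp : ∀ h b c, 0 < M h b c := fun h b c => hp.trans_le (hM0 h b c)
  have hM'p : ∀ h b c, 0 < M' h b c := fun h b c => hp.trans_le (hM'0 h b c)
  set D := modelDist M' M with hD
  set L : B × B × H → ℝ := fun x =>
    Real.log (M' x.2.2 x.2.1 x.1) - Real.log (M x.2.2 x.2.1 x.1) with hL
  have hLb : ∀ x, |L x| ≤ D / p := fun x => by
    refine (abs_log_sub_log_le hp (hM'0 _ _ _) (hM0 _ _ _)).trans ?_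
    refine div_le_div_of_nonneg_right (le_trans ?_
      (sum_abs_sub_le_modelDist M' M x.2.2 x.2.1)) hp.le
    exact Finset.single_le_sum (f := fun c => |M' x.2.2 x.2.1 c - M x.2.2 x.2.1 c|)
      (fun _ _ => abs_nonneg _) (Finset.mem_univ x.1)
  have hD0 : 0 ≤ D := by
    obtain ⟨h⟩ := ‹Nonempty H›
    obtain ⟨b⟩ := ‹Nonempty B›
    exact (Finset.sum_nonneg fun c _ => abs_nonneg _).trans (sum_abs_sub_le_modelDist M' M h b)
  -- the number of visits to the pair `(b, h)`
  set n : B × H → ℝ := fun y => ∑ c, visits z T (c, y) s with hn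
  have hscore : ∀ x, ∑ t ∈ Finset.range T, score M x (z t s)
      = visits z T x s - n x.2 * M x.2.2 x.2.1 x.1 := fun x => by
    rw [sum_range_comp_eq_sum_visits_mul z T (score M x)]
    simp only [score, mul_sub, Finset.sum_sub_distrib]
    congr 1
    · simp
    · rw [Fintype.sum_prod_type_right]
      simp only [mul_ite, mul_zero]
      rw [Finset.sum_eq_single x.2]
      · simp [← Finset.sum_mul, hn]
      · intro y _ hy
        simp [hy]
      · simp
  have hlik : 0 ≤ ∑ x, visits z T x s * L x := by
    rw [← sum_range_comp_eq_sum_visits_mul z T L]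
    simp only [hL, Finset.sum_sub_distrib]
    rw [← Real.log_prod fun t _ => (hM'p _ _ _).ne', ← Real.log_prod fun t _ => (hMp _ _ _).ne',
      sub_nonneg]
    exact Real.log_le_log (Finset.prod_pos fun t _ => hMp _ _ _) hML
  have hlin : ∑ x, (∑ t ∈ Finset.range T, score M x (z t s)) * L x ≤
      Fintype.card (B × B × H) * w * (D / p) := by
    have hw0 : 0 ≤ w := by
      obtain ⟨h⟩ := ‹Nonempty H›
      obtain ⟨b⟩ := ‹Nonempty B›
      exact (abs_nonneg _).trans (hw (b, b, h))
    calc _ ≤ ∑ _x : B × B × H, w * (D / p) := Finset.sum_le_sum fun x _ => by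
          refine (le_abs_self _).trans ?_
          rw [abs_mul]
          exact mul_le_mul (hw x) (hLb x) (abs_nonneg _) hw0
      _ = _ := by rw [Finset.sum_const, Finset.card_univ, nsmul_eq_mul, mul_assoc]
  have hsplit : ∑ x, (∑ t ∈ Finset.range T, score M x (z t s)) * L x
      = ∑ x, visits z T x s * L x - ∑ y : B × H, n y * ∑ c, M y.2 y.1 c * L (c, y) := by
    rw [Fintype.sum_prod_type_right (f := fun x => visits z T x s * L x),
      Fintype.sum_prod_type_right, ← Finset.sum_sub_distrib]
    refine Finset.sum_congr rfl fun y _ => ?_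
    rw [Finset.mul_sum, ← Finset.sum_sub_distrib]
    refine Finset.sum_congr rfl fun c _ => ?_
    rw [hscore]
    ring
  obtain ⟨⟨h₀, b₀⟩, hmax⟩ : ∃ q : H × B, ∑ c, |M' q.1 q.2 c - M q.1 q.2 c| = D :=
    exists_eq_ciSup_of_finite
  have hn0 : ∀ y, 0 ≤ n y := fun y => Finset.sum_nonneg fun c _ => Finset.sum_nonneg fun t _ => by
    split_ifs <;> norm_num
  have hrow : ∀ y : B × H, 4 * Fintype.card B * ∑ c, M y.2 y.1 c * L (c, y) ≤
      -(∑ c, |M' y.2 y.1 c - M y.2 y.1 c|) ^ 2 := fun y =>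
    sum_mul_log_sub_log_le (hMp y.2 y.1) (hM'p y.2 y.1) (hM1 y.2 y.1) (hM'1 y.2 y.1)
  have hn_lower : v ≤ n (b₀, h₀) := (hv (b₀, b₀, h₀)).trans
    (Finset.single_le_sum (f := fun c => visits z T (c, b₀, h₀) s) (fun c _ =>
      Finset.sum_nonneg fun t _ => by split_ifs <;> norm_num) (Finset.mem_univ b₀))
  have hent : v * D ^ 2 ≤
      -(4 * Fintype.card B * ∑ y : B × H, n y * ∑ c, M y.2 y.1 c * L (c, y)) := by
    calc v * D ^ 2 ≤ n (b₀, h₀) * (∑ c, |M' h₀ b₀ c - M h₀ b₀ c|) ^ 2 := by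
          rw [← hmax]
          exact mul_le_mul_of_nonneg_right hn_lower (sq_nonneg _)
      _ ≤ ∑ y : B × H, n y * (∑ c, |M' y.2 y.1 c - M y.2 y.1 c|) ^ 2 :=
          Finset.single_le_sum
            (f := fun y : B × H => n y * (∑ c, |M' y.2 y.1 c - M y.2 y.1 c|) ^ 2)
            (fun y _ => mul_nonneg (hn0 y) (sq_nonneg _)) (Finset.mem_univ (b₀, h₀))
      _ ≤ _ := by
          rw [Finset.mul_sum, ← Finset.sum_neg_distrib]
          refine Finset.sum_le_sum fun y _ => ?_
          have := mul_le_mul_of_nonneg_left (hrow y) (hn0 y)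
          linarith
  have hcard : (0 : ℝ) ≤ 4 * Fintype.card B := by positivity
  nlinarith [mul_le_mul_of_nonneg_left (hsplit ▸ hlin) hcard, mul_nonneg hcard hlik]

end Model

/-! ### The truncated Gaussian model -/

section Gauss

variable {n d : ℕ} {B : Finset (Fin n → ℝ)} {H : Finset (Fin d → ℝ)}

lemma sum_gaussWeight_pos [Nonempty B] (ω : Param n d) (h : H) (b : B) :
    0 < ∑ c : B, gaussWeight ω h.1 b.1 c.1 :=
  Finset.sum_pos (fun _ _ => Real.exp_pos _) Finset.univ_nonempty

lemma gaussModel_pos (ω : Param n d) (h : H) (b c : B) : 0 < gaussModel ω h b c :=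
  have : Nonempty B := ⟨b⟩
  div_pos (Real.exp_pos _) (sum_gaussWeight_pos ω h b)

lemma sum_gaussModel (ω : Param n d) (h : H) (b : B) : ∑ c, gaussModel ω h b c = 1 := by
  have : Nonempty B := ⟨b⟩
  simp only [gaussModel]
  rw [← Finset.sum_div, div_self (sum_gaussWeight_pos ω h b).ne']

lemma continuous_gaussModel (h : H) (b c : B) :
    Continuous fun ω : Param n d => gaussModel ω h b c := by
  have hw : ∀ c : Fin n → ℝ, Continuous fun ω : Param n d => gaussWeight ω h.1 b.1 c := fun c => by
    unfold gaussWeight dotProduct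
    fun_prop
  have : Nonempty B := ⟨b⟩
  exact (hw c.1).div (continuous_finsetSum _ fun c _ => hw c.1)
    fun ω => (sum_gaussWeight_pos ω h b).ne'

/-- The transition probabilities are bounded below uniformly over a bounded parameter set, since
they are continuous and positive on its compact closure. -/
lemma exists_pos_le_gaussModel {Θ : Set (Param n d)} (hΘ : Bornology.IsBounded Θ) :
    ∃ p > 0, ∀ ω ∈ Θ, ∀ (h : H) (b c : B), p ≤ gaussModel ω h b c := by
  have hK : IsCompact (closure Θ) := hΘ.isCompact_closure
  have h1 : ∀ q : H × B × B, ∃ p > 0, ∀ ω ∈ Θ, p ≤ gaussModel ω q.1 q.2.1 q.2.2 := fun q => by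
    obtain ⟨p, hp, hle⟩ := hK.exists_forall_le' (a := 0)
      (continuous_gaussModel q.1 q.2.1 q.2.2).continuousOn fun ω _ => gaussModel_pos ω _ _ _
    exact ⟨p, hp, fun ω hω => hle ω (subset_closure hω)⟩
  choose p hp hle using h1
  rcases isEmpty_or_nonempty (H × B × B) with hemp | hne
  · exact ⟨1, one_pos, fun ω _ h b c => hemp.elim (h, b, c)⟩
  · obtain ⟨q, hq⟩ := Finite.exists_min p
    exact ⟨p q, hp q, fun ω hω h b c => (hq (h, b, c)).trans (hle _ ω hω)⟩

end Gauss

/-! ### Concentration of the learned model -/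

/-- The event that the learned model is `ε`-far from the true one is contained in the union, over all
triples, of the events that a triple is visited rarely or that its score is large. -/
lemma measureReal_le_modelDist {S B H U : Type*} [MeasurableSpace S] [MeasurableSpace B]
    [MeasurableSpace U] [MeasurableSpace H] [MeasurableSingletonClass B]
    [MeasurableSingletonClass H] [Fintype B] [Fintype H] [DecidableEq B] [DecidableEq H]
    [Nonempty B] [Nonempty H] {p : ℝ} (hp : 0 < p) {M : H → B → B → ℝ}
    (hM0 : ∀ h b c, p ≤ M h b c) (hM1 : ∀ h b, ∑ c, M h b c = 1) {sig : B → U → H}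
    (hsig : ∀ b, Measurable (sig b)) {ν : Measure U} [IsProbabilityMeasure ν] {μ : Measure S}
    [IsProbabilityMeasure μ] {b : ℕ → S → B} {u : ℕ → S → U}
    (hproc : IsBehaviorProcess M sig ν μ b u) {N : ℕ} (hN : 0 < N) {δ : ℝ} (hδ0 : 0 < δ)
    (hδ : ∀ x y, δ ≤ (tripleTransition M sig ν ^ N) x y) {M' : S → H → B → B → ℝ} {T : ℕ}
    (hM' : ∀ᵐ s ∂μ, (∀ h b c, p ≤ M' s h b c) ∧ (∀ h b, ∑ c, M' s h b c = 1) ∧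
      ∏ t ∈ Finset.range T, M (sig (b t s) (u t s)) (b t s) (b (t + 1) s) ≤
        ∏ t ∈ Finset.range T, M' s (sig (b t s) (u t s)) (b t s) (b (t + 1) s))
    (hT : 0 < T) (hTN : 4 * N ≤ T * δ) {ε : ℝ} (hε : 0 < ε) {κ : ℝ}
    (hκ : κ = p / (16 * Fintype.card B * Fintype.card (B × B × H)))
    (hTκ : 4 ≤ κ * T * δ * ε) :
    μ.real {s | ε ≤ modelDist (M' s) M} ≤ Fintype.card (B × B × H) *
      (2 * Real.exp (-((κ * T * δ * ε) ^ 2 / (8 * T))) +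
        Real.exp (-(T * δ ^ 2 / (32 * N ^ 2)))) := by
  have hM00 : ∀ h b c, 0 ≤ M h b c := fun h b c => hp.le.trans (hM0 h b c)
  have hQ := tripleTransition_mem_rowStochastic hM00 hM1 hsig ν
  have hz := hproc.isMarkovChain hsig
  set z : ℕ → S → B × B × H := fun t s => (b (t + 1) s, b t s, sig (b t s) (u t s))
  let A : B × B × H → Set S := fun x =>
    {s | κ * T * δ * ε ≤ |∑ t ∈ Finset.range T, score M x (z t s)|} ∪
      {s | visits z T x s < T * δ / 2}
  have hA : ∀ x, μ.real (A x) ≤ 2 * Real.exp (-((κ * T * δ * ε) ^ 2 / (8 * T))) +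
      Real.exp (-(T * δ ^ 2 / (32 * N ^ 2))) := fun x =>
    (measureReal_union_le _ _).trans (add_le_add
      (hz.measureReal_le_abs_sum hQ (abs_score_le_one hM00 hM1 x)
        (sum_tripleTransition_mul_score hM1 sig ν x) hT hTκ)
      (hz.measureReal_visits_lt hQ hN (fun y => hδ y x) hT hTN))
  have hsub : {s | ε ≤ modelDist (M' s) M} ≤ᵐ[μ] ⋃ x, A x := by
    filter_upwards [hM'] with s hs hεD
    have hεD : ε ≤ modelDist (M' s) M := hεD
    obtain ⟨h0, h1, hML⟩ := hs
    by_contra hnot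
    have hnot : s ∉ ⋃ x, A x := hnot
    simp only [A, Set.mem_iUnion, Set.mem_union, Set.mem_ofPred_eq, not_exists, not_or, not_le,
      not_lt] at hnot
    have hkey := visits_mul_modelDist_sq_le hp hM0 hM1 h0 h1 hML (fun x => (hnot x).2)
      (fun x => (hnot x).1.le)
    set D := modelDist (M' s) M
    have hT' : (0 : ℝ) < T := by exact_mod_cast hT
    have hB : (0 : ℝ) < Fintype.card B := by exact_mod_cast Fintype.card_pos
    have hK : (0 : ℝ) < Fintype.card (B × B × H) := by exact_mod_cast Fintype.card_pos
    -- the choice of `κ` turns the bound into `D ^ 2 ≤ D * ε / 2`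
    have hrhs : 4 * Fintype.card B * (Fintype.card (B × B × H) * (κ * T * δ * ε) * (D / p))
        = T * δ / 2 * (D * ε / 2) := by
      rw [hκ]
      field_simp
      ring
    rw [hrhs] at hkey
    have hD := le_of_mul_le_mul_left hkey (by positivity)
    have hD0 : 0 < D := hε.trans_le hεD
    nlinarith
  calc μ.real {s | ε ≤ modelDist (M' s) M} ≤ μ.real (⋃ x, A x) :=
        ENNReal.toReal_mono (measure_ne_top _ _) (measure_mono_ae hsub)
    _ ≤ ∑ x, μ.real (A x) := measureReal_iUnion_fintype_le _
    _ ≤ ∑ _x : B × B × H, _ := Finset.sum_le_sum fun x _ => hA x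
    _ = _ := by rw [Finset.sum_const, Finset.card_univ, nsmul_eq_mul]

/-- A probability bounded by a large multiple of `exp (-r Y)` with `r` large is at most
`2 exp (-Y)`: for small `Y` the claim is trivial, and otherwise the excess exponent absorbs the
prefactor. -/
lemma le_two_mul_exp_of_le {P K Y : ℝ} (hK : 1 ≤ K) (hP : P ≤ 1)
    (h : P ≤ 3 * K * Real.exp (-(49 * K ^ 2 * Y))) : P ≤ 2 * Real.exp (-Y) := by
  rcases le_or_gt Y (1 / 2) with hY | hY
  · have := Real.add_one_le_exp (-Y)
    linarith
  · have hsplit : Real.exp (-(49 * K ^ 2 * Y)) = Real.exp (-((49 * K ^ 2 - 1) * Y)) *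
        Real.exp (-Y) := by rw [← Real.exp_add]; ring_nf
    have hu : 3 * K ≤ Real.exp ((49 * K ^ 2 - 1) * Y) := by
      have := Real.add_one_le_exp ((49 * K ^ 2 - 1) * Y)
      have : 6 * K * (1 / 2) ≤ (49 * K ^ 2 - 1) * Y :=
        mul_le_mul (by nlinarith) hY.le (by norm_num) (by nlinarith)
      linarith
    have h1 : 3 * K * Real.exp (-((49 * K ^ 2 - 1) * Y)) ≤ 1 := by
      rw [Real.exp_neg, ← div_eq_mul_inv, div_le_one (Real.exp_pos _)]
      exact hu
    rw [hsplit, ← mul_assoc] at h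
    nlinarith [Real.exp_pos (-Y)]

/-- The union bound of `measureReal_le_modelDist` in the form with the constant
`C = 56 K ^ 2 / κ`. -/
lemma le_two_mul_exp_of_le_union_bound {P K κ N δ ε T : ℝ} (hP : P ≤ 1) (hK : 1 ≤ K)
    (hκ0 : 0 < κ) (hκ1 : κ ≤ 1) (hN : 1 ≤ N) (hδ : 0 < δ) (hε : 0 < ε) (hε2 : ε ≤ 2)
    (hT : 0 < T) (hT2 : 2 * (56 * K ^ 2 / κ) * N ≤ T * ε * K * δ)
    (h : P ≤ K * (2 * Real.exp (-((κ * T * δ * ε) ^ 2 / (8 * T))) +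
      Real.exp (-(T * δ ^ 2 / (32 * N ^ 2))))) :
    P ≤ 2 * Real.exp (-((T * ε * K * δ - 2 * (56 * K ^ 2 / κ) * N) ^ 2 /
      (2 * T * N ^ 2 * (56 * K ^ 2 / κ) ^ 2))) := by
  have hK0 : 0 < K := by linarith
  have hN0 : 0 < N := by linarith
  set C := 56 * K ^ 2 / κ with hC
  have hC0 : 0 < C := by positivity
  set X := T * δ ^ 2 * ε ^ 2 / N ^ 2 with hX
  have hX0 : 0 < X := by positivity
  set Y := (T * ε * K * δ) ^ 2 / (2 * T * N ^ 2 * C ^ 2) with hY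
  have hXY : 49 * K ^ 2 * Y = κ ^ 2 * X / 128 := by
    rw [hY, hX, hC]
    field_simp
    ring
  have h1 : κ ^ 2 * X / 128 ≤ (κ * T * δ * ε) ^ 2 / (8 * T) := by
    have : (κ * T * δ * ε) ^ 2 / (8 * T) = κ ^ 2 * X * N ^ 2 / 8 := by
      rw [hX]
      field_simp
    rw [this]
    have : κ ^ 2 * X * 1 ≤ κ ^ 2 * X * N ^ 2 :=
      mul_le_mul_of_nonneg_left (one_le_pow₀ hN) (by positivity)
    have : 0 < κ ^ 2 * X := by positivity
    linarith
  have h2 : κ ^ 2 * X / 128 ≤ T * δ ^ 2 / (32 * N ^ 2) := by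
    have : κ ^ 2 * X = T * δ ^ 2 / N ^ 2 * (κ ^ 2 * ε ^ 2) := by
      rw [hX]
      field_simp
    have h3 : T * δ ^ 2 / (32 * N ^ 2) = T * δ ^ 2 / N ^ 2 * (1 * 2 ^ 2) / 128 := by
      field_simp
      norm_num
    rw [this, h3]
    gcongr
    exact pow_le_one₀ hκ0.le hκ1
  have hPY : P ≤ 2 * Real.exp (-Y) := by
    refine le_two_mul_exp_of_le hK hP (h.trans ?_)
    rw [hXY]
    have e1 := Real.exp_le_exp.2 (neg_le_neg h1)
    have e2 := Real.exp_le_exp.2 (neg_le_neg h2)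
    nlinarith
  refine hPY.trans (mul_le_mul_of_nonneg_left (Real.exp_le_exp.2 (neg_le_neg ?_)) (by norm_num))
  rw [hY]
  refine div_le_div_of_nonneg_right (pow_le_pow_left₀ (by linarith) ?_ 2) (by positivity)
  have : 0 < 2 * C * N := by positivity
  linarith

/-- Expanding the square, the exponents of the two sides differ by the bounded quantity
`2 a c / v`, up to a term of the favourable sign. -/
lemma isBigO_exp_neg_sq_div {a c v : ℝ} (hv : 0 < v) :
    (fun T : ℕ => 2 * Real.exp (-((T * a - c) ^ 2 / (T * v))))
      =O[atTop] fun T : ℕ => Real.exp (-(a ^ 2 / v * T)) := by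
  refine IsBigO.of_bound (2 * Real.exp (2 * a * c / v)) ?_
  filter_upwards [eventually_gt_atTop 0] with T hT
  have hT' : (0 : ℝ) < T := by exact_mod_cast hT
  rw [Real.norm_of_nonneg (by positivity), Real.norm_of_nonneg (Real.exp_pos _).le, mul_assoc,
    ← Real.exp_add]
  refine mul_le_mul_of_nonneg_left (Real.exp_le_exp.2 ?_) (by norm_num)
  have : (T * a - c) ^ 2 / (T * v) = a ^ 2 / v * T - 2 * a * c / v + c ^ 2 / (T * v) := by
    field_simp
    ring
  have : 0 ≤ c ^ 2 / (T * v) := by positivity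
  linarith

theorem theorem2 {n d : ℕ} (B : Finset (Fin n → ℝ)) (H : Finset (Fin d → ℝ))
    (Θ : Set (Param n d)) (hΘ : Bornology.IsBounded Θ) :
    ∃ C₁ : ℝ, 0 < C₁ ∧
      ∀ (A U S : Type*) [MeasurableSpace U] [MeasurableSpace S]
        (ν : Measure U) [IsProbabilityMeasure ν] (μ : Measure S) [IsProbabilityMeasure μ]
        (sig : A → B → U → H) (a₀ : A) (_ : ∀ b, Measurable (sig a₀ b))
        (ωstar : Param n d) (_ : ωstar ∈ Θ)
        (b : ℕ → S → B) (u : ℕ → S → U)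
        (_ : IsBehaviorProcess (gaussModel ωstar) (sig a₀) ν μ b u)
        (N₀ : ℕ) (_ : 0 < N₀) (δ₀ : ℝ) (_ : 0 < δ₀)
        (_ : IsLeast (Set.range fun p : (B × B × H) × (B × B × H) =>
          (tripleTransition (gaussModel ωstar) (sig a₀) ν ^ N₀) p.1 p.2) δ₀)
        (ε : ℝ) (_ : 0 < ε),
        (∀ (T : ℕ), (T : ℝ) > 2 * C₁ * N₀ / ((B.card : ℝ) ^ 2 * H.card * δ₀ * ε) →
          ∀ ωhat : S → Param n d,
            (∀ᵐ s ∂μ, IsMaxLikelihood Θ T (fun t => b t s)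
              (fun t => sig a₀ (b t s) (u t s)) (ωhat s)) →
            μ.real {s | ε ≤ modelDist (gaussModel (B := B) (H := H) (ωhat s))
                (gaussModel ωstar)} ≤
              2 * Real.exp (-((T * ε * (B.card : ℝ) ^ 2 * H.card * δ₀ - 2 * C₁ * N₀) ^ 2 /
                (2 * T * (N₀ : ℝ) ^ 2 * C₁ ^ 2)))) ∧
        (fun T : ℕ => 2 * Real.exp
            (-((T * ε * (B.card : ℝ) ^ 2 * H.card * δ₀ - 2 * C₁ * N₀) ^ 2 /
              (2 * T * (N₀ : ℝ) ^ 2 * C₁ ^ 2))))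
          =O[atTop] fun T : ℕ => Real.exp
            (-((ε * (B.card : ℝ) ^ 2 * H.card * δ₀) ^ 2 / (2 * (N₀ : ℝ) ^ 2 * C₁ ^ 2) * T)) := by

  by_cases hne : Nonempty B ∧ Nonempty H
  swap
  · refine ⟨1, one_pos, ?_⟩
    intro A U S _ _ ν _ μ _ sig a₀ _ ωstar _ b u
    obtain ⟨s⟩ := nonempty_of_isProbabilityMeasure μ
    obtain ⟨v⟩ := nonempty_of_isProbabilityMeasure ν
    exact absurd ⟨⟨b 0 s⟩, ⟨sig a₀ (b 0 s) v⟩⟩ hne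
  obtain ⟨_, _⟩ := hne
  obtain ⟨p, hp, hpΘ⟩ := exists_pos_le_gaussModel (B := B) (H := H) hΘ
  have hcard : (Fintype.card (B × B × H) : ℝ) = (B.card : ℝ) ^ 2 * H.card := by
    simp only [Fintype.card_prod, Fintype.card_coe, Nat.cast_mul]
    ring
  set K : ℝ := (B.card : ℝ) ^ 2 * H.card with hKdef
  have hK : 1 ≤ K := by
    rw [← hcard]
    exact_mod_cast Fintype.card_pos (α := B × B × H)
  have hBcard : (1 : ℝ) ≤ B.card := by
    rw [← Fintype.card_coe B]
    exact_mod_cast Fintype.card_pos (α := B)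
  set κ : ℝ := p / (16 * B.card * K) with hκ
  have hκ0 : 0 < κ := by positivity
  have hC : 0 < 56 * K ^ 2 / κ := by positivity
  refine ⟨56 * K ^ 2 / κ, hC, ?_⟩
  intro A U S _ _ ν _ μ _ sig a₀ hsig ωstar hωstar b u hproc N₀ hN₀ δ₀ hδ₀ hleast ε hε
  set C := 56 * K ^ 2 / κ with hCdef
  have hN₀' : (1 : ℝ) ≤ N₀ := by exact_mod_cast hN₀
  constructor
  · intro T hT ωhat hML
    have hKδε : 0 < K * δ₀ * ε := by positivity
    have hTK : 2 * C * N₀ < T * ε * K * δ₀ := by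
      have := (div_lt_iff₀ hKδε).1 hT
      linarith
    have hT0 : (0 : ℝ) < T := lt_of_le_of_lt (by positivity) hT
    rcases lt_or_ge 2 ε with hε2 | hε2
    · have hempty : {s | ε ≤ modelDist (gaussModel (B := B) (H := H) (ωhat s))
          (gaussModel ωstar)} = ∅ := by
        refine Set.eq_empty_iff_forall_notMem.2 fun s hs => ?_
        have := modelDist_le_two (fun h b c => (gaussModel_pos (ωhat s) h b c).le)
          (sum_gaussModel (B := B) (H := H) (ωhat s))
          (fun h b c => (gaussModel_pos ωstar h b c).le) (sum_gaussModel ωstar)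
        exact absurd (hs.trans this) (not_le.2 hε2)
      rw [hempty, measureReal_empty]
      positivity
    have hp1 : p ≤ 1 := by
      obtain ⟨h⟩ := ‹Nonempty H›
      obtain ⟨c⟩ := ‹Nonempty B›
      rw [← sum_gaussModel ωstar h c]
      exact (hpΘ ωstar hωstar h c c).trans (Finset.single_le_sum
        (fun i _ => (gaussModel_pos ωstar h c i).le) (Finset.mem_univ c))
    have hκ1 : κ ≤ 1 := by
      rw [hκ, div_le_one (by positivity)]
      nlinarith
    have hTκ : 112 * K * N₀ < κ * T * δ₀ * ε := by
      have h1 : 2 * C * N₀ * (κ / K) = 112 * K * N₀ := by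
        rw [hCdef]
        field_simp
        norm_num
      have h2 : T * ε * K * δ₀ * (κ / K) = κ * T * δ₀ * ε := by
        field_simp
      rw [← h1, ← h2]
      exact mul_lt_mul_of_pos_right hTK (by positivity)
    have hKN : (1 : ℝ) * N₀ ≤ K * N₀ := mul_le_mul_of_nonneg_right hK (by linarith)
    have hTN : 4 * (N₀ : ℝ) ≤ T * δ₀ := by
      have h1 : κ * (T * δ₀ * ε) ≤ 1 * (T * δ₀ * ε) :=
        mul_le_mul_of_nonneg_right hκ1 (by positivity)
      have h2 : T * δ₀ * ε ≤ T * δ₀ * 2 := mul_le_mul_of_nonneg_left hε2 (by positivity)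
      linarith
    have hbound := measureReal_le_modelDist hp (hpΘ ωstar hωstar) (sum_gaussModel ωstar) hsig hproc
      hN₀ hδ₀ (fun x y => hleast.2 ⟨(x, y), rfl⟩)
      (M' := fun s => gaussModel (ωhat s)) (T := T) (κ := κ)
      (by
        filter_upwards [hML] with s hs
        exact ⟨hpΘ _ hs.1, sum_gaussModel _, hs.2 hωstar⟩)
      (by exact_mod_cast hT0) hTN hε (by rw [hκ, hcard, Fintype.card_coe]) (by linarith)
    rw [hcard] at hbound
    have := le_two_mul_exp_of_le_union_bound measureReal_le_one hK hκ0 hκ1 hN₀' hδ₀ hε hε2 hT0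
      hTK.le hbound
    simpa only [hKdef, mul_assoc] using this
  · have h := isBigO_exp_neg_sq_div (a := ε * K * δ₀) (c := 2 * C * N₀)
      (v := 2 * (N₀ : ℝ) ^ 2 * C ^ 2) (by positivity)
    refine (h.congr_left fun T => ?_).trans (isBigO_of_le _ fun T => le_of_eq ?_)
    · simp only [hKdef]
      ring_nf
    · simp only [hKdef]
      ring_nf
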